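/- Let $\Gamma$ be a torsion-free word hyperbolic group and let $T$ be a finite generating set of $\Gamma$. For $\gamma\in\Gamma$ let $\|\gamma\|=\min_{x\in\Gamma} d_T(x,\gamma x)$ be the translation length of $\gamma$ on $\Gamma$ with its word metric $d_T$ (equivalently, the minimal $T$-word length of a conjugate of $\gamma$). For $\phi\in\mathrm{Out}(\Gamma)$ and $\beta\in\Gamma$ let $\|\phi(\beta)\|=\|\bar\phi(\beta)\|$, where $\bar\phi\in\mathrm{Aut}(\Gamma)$ is any representative of $\phi$. Say that $\mathcal B\subset\Gamma$ is *sufficient* if for every $K\in\mathbb R$ the set $$\{\phi\in\mathrm{Out}(\Gamma)\ :\ \|\phi(\beta)\|\le K\ \text{ for all }\beta\in\mathcal B\}$$ is finite. Then: 1. There is a finite sufficient set $\mathcal B\subset\Gamma$. 2. More precisely, for every finite generating set $S$ of $\Gamma$ there is an integer $n>0$ such that $$\mathcal B=\{s^n : s\in S\}\cup\{s^nt^n : s,t\in S,\ s\ne t\}$$ is sufficient. 3. Suppose that $\Gamma$ admits a convex cocompact action on the symmetric space associated to a rank one Lie group; that is, there is a connected semisimple Lie group $G$ with trivial center, without compact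 factors and of real rank one, a maximal compact subgroup $K_0\subset G$ with symmetric space $X=G/K_0$, and a discrete, faithful representation $\rho:\Gamma\to G$ such that $N_\rho=X/\rho(\Gamma)$ contains a compact convex subset (one that contains every geodesic arc of $N_\rho$ with both endpoints in it) whose inclusion into $N_\rho$ is a homotopy equivalence. Then for every finite generating set $S$ of $\Gamma$ the set $$\mathcal B=S\cup\{st : s,t\in S\}$$ is sufficient. -/

import Mathlib

open scoped Manifold ContDiff Pointwise

noncomputable section

/-! ### Word metrics, hyperbolic groups, conjugacy length -/

section WordMetric

variable {Γ : Type*} [Group Γ]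

/-- `S` is a finite generating set of the group `Γ`. -/
def IsFiniteGenSet (S : Set Γ) : Prop :=
  S.Finite ∧ Subgroup.closure S = ⊤

/-- The word length of `g` with respect to `S`: the least length of a word in the letters
`S ∪ S⁻¹` that represents `g`. -/
def wordLength (S : Set Γ) (g : Γ) : ℕ :=
  sInf {n : ℕ | ∃ l : List Γ, l.length = n ∧ (∀ x ∈ l, x ∈ S ∨ x⁻¹ ∈ S) ∧ l.prod = g}

/-- The left-invariant word metric, that is, the path metric of the Cayley graph restricted to
its vertex set. -/
def wordDist (S : Set Γ) (g h : Γ) : ℕ :=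
  wordLength S (g⁻¹ * h)

/-- The translation length `‖γ‖` of the left action of `γ` on `Γ` with its word metric. -/
def conjLength (S : Set Γ) (γ : Γ) : ℕ :=
  sInf (Set.range fun x : Γ => wordDist S x (γ * x))

lemma conjLength_conj (S : Set Γ) (g γ : Γ) :
    conjLength S (g * γ * g⁻¹) = conjLength S γ := by
  unfold conjLength wordDist
  congr 1
  ext n
  constructor
  · rintro ⟨x, rfl⟩
    exact ⟨g⁻¹ * x, by simp [mul_assoc]⟩
  · rintro ⟨x, rfl⟩
    exact ⟨g * x, by simp [mul_assoc]⟩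

variable (Γ) in
/-- Gromov's word hyperbolicity: `Γ` is finitely generated and a word metric of `Γ` satisfies
the four-point condition for some `δ`. -/
def IsWordHyperbolic : Prop :=
  ∃ S : Set Γ, IsFiniteGenSet S ∧ ∃ δ : ℝ, ∀ x y z w : Γ,
    (wordDist S x z : ℝ) + wordDist S y w ≤
      max ((wordDist S x y : ℝ) + wordDist S z w) ((wordDist S x w : ℝ) + wordDist S y z) + 2 * δ

variable (Γ) in
/-- The outer automorphism group `Out(Γ) = Aut(Γ) / Inn(Γ)` (as a set of cosets). -/
abbrev OutAut : Type _ := MulAut Γ ⧸ (MulAut.conj : Γ →* MulAut Γ).range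

/-- `‖φ(β)‖` for an outer automorphism `φ`. -/
def outConjLength (S : Set Γ) (φ : OutAut Γ) (β : Γ) : ℕ :=
  Quotient.liftOn' φ (fun f => conjLength S (f β)) (by
    intro f f' h
    obtain ⟨g, hg⟩ := QuotientGroup.leftRel_apply.mp h
    have hf : f' = f * MulAut.conj g := by rw [hg, mul_inv_cancel_left]
    subst hf
    simp [conjLength_conj])

/-- For every `K`, only finitely many outer automorphisms `φ` satisfy `‖φ(β)‖ ≤ K` for all
`β ∈ B`; here `‖·‖` is computed with the finite generating set `T`. -/
def BoundsOuterAutomorphisms (T B : Set Γ) : Prop :=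
  ∀ K : ℝ, {φ : OutAut Γ | ∀ β ∈ B, (outConjLength T φ β : ℝ) ≤ K}.Finite

end WordMetric

/-! ### Rank one Lie groups -/

/-- The real rank of a real semisimple Lie algebra: the largest dimension of an abelian
subalgebra all of whose elements are `ad`-diagonalizable over `ℝ`. -/
def lieRealRank (L : Type*) [LieRing L] [LieAlgebra ℝ L] : ℕ :=
  sSup {n : ℕ | ∃ a : LieSubalgebra ℝ L, IsLieAbelian a ∧
    (∀ x ∈ a, ⨆ μ : ℝ, Module.End.eigenspace (LieAlgebra.ad ℝ L x) μ = ⊤) ∧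
    Module.finrank ℝ a = n}

section LieGroups

instance instLieGroupMinSmoothness (d : ℕ) (G : Type*) [Group G] [TopologicalSpace G]
    [ChartedSpace (EuclideanSpace ℝ (Fin d)) G] [LieGroup (𝓡 d) ∞ G] :
    LieGroup (𝓡 d) (minSmoothness ℝ 3) G :=
  LieGroup.of_le (n := ∞) (by
    rw [minSmoothness_of_isRCLikeNormedField]
    exact ENat.LEInfty.out)

/-- The Lie group `G` (of dimension `d`) is a connected semisimple Lie group with trivial center,
without compact factors, and of rank one. -/
structure IsRankOneLieGroup (d : ℕ) (G : Type*) [Group G] [TopologicalSpace G]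
    [ChartedSpace (EuclideanSpace ℝ (Fin d)) G] [LieGroup (𝓡 d) ∞ G] : Prop where
  hausdorff : T2Space G
  connected : ConnectedSpace G
  semisimple : LieAlgebra.IsSemisimple ℝ (GroupLieAlgebra (𝓡 d) G)
  center_eq_bot : Subgroup.center G = ⊥
  no_compact_factor : ∀ N : Subgroup G, N.Normal → IsCompact (N : Set G) →
    IsConnected (N : Set G) → N = ⊥
  rank_one : lieRealRank (GroupLieAlgebra (𝓡 d) G) = 1

end LieGroups

/-! ### The symmetric space `X = G / K` and convex cocompact representations -/

section SymmetricSpace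

variable {Γ G : Type*} [Group Γ] [Group G] [TopologicalSpace G]

/-- `K` is a maximal compact subgroup of `G`. -/
def IsMaximalCompactSubgroup (K : Subgroup G) : Prop :=
  Maximal (fun H : Subgroup G => IsCompact (H : Set G)) K

/-- `θ` is the Cartan involution of `G` attached to the maximal compact subgroup `K`: a continuous
involutive automorphism with fixed point group `K`. -/
def IsCartanInvolution (K : Subgroup G) (θ : G ≃* G) : Prop :=
  Continuous θ ∧ (∀ g, θ (θ g) = g) ∧ ∀ g, θ g = g ↔ g ∈ K

/-- The (complete, constant speed, possibly constant) geodesics of the symmetric space `X = G / K`: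
the curves `t ↦ g · c(t) · K`, where `c` is a one-parameter subgroup of `G` which is inverted by the
Cartan involution (a one-parameter group of transvections along a geodesic through `K`). -/
def IsSymmGeodesic (K : Subgroup G) (γ : ℝ → G ⧸ K) : Prop :=
  ∃ θ : G ≃* G, IsCartanInvolution K θ ∧
    ∃ c : ℝ → G, Continuous c ∧ (∀ s t, c (s + t) = c s * c t) ∧ (∀ t, θ (c t) = (c t)⁻¹) ∧
      ∃ g : G, ∀ t, γ t = ((g * c t : G) : G ⧸ K)

/-- The locally symmetric space `N_ρ = X / ρ(Γ)`, with the quotient topology. -/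
abbrev LocSymmSpace (K : Subgroup G) (ρ : Γ →* G) : Type _ :=
  Quotient (MulAction.orbitRel ρ.range (G ⧸ K))

/-- `A ⊆ N_ρ` is convex: every geodesic arc of `N_ρ` (the image of a geodesic arc of `X`) with both
endpoints in `A` is contained in `A`. -/
def IsGeodesicallyConvex (K : Subgroup G) (ρ : Γ →* G) (A : Set (LocSymmSpace K ρ)) : Prop :=
  ∀ γ : ℝ → G ⧸ K, IsSymmGeodesic K γ → ∀ a b : ℝ, a ≤ b →
    (Quotient.mk _ (γ a) : LocSymmSpace K ρ) ∈ A →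
    (Quotient.mk _ (γ b) : LocSymmSpace K ρ) ∈ A →
    ∀ t ∈ Set.Icc a b, (Quotient.mk _ (γ t) : LocSymmSpace K ρ) ∈ A

/-- `ρ` is convex cocompact: it is discrete and faithful, and `N_ρ` contains a compact convex subset
whose inclusion into `N_ρ` is a homotopy equivalence. -/
structure IsConvexCocompact (K : Subgroup G) (ρ : Γ →* G) : Prop where
  discrete : DiscreteTopology ρ.range
  faithful : Function.Injective ρ
  exists_core : ∃ A : Set (LocSymmSpace K ρ), IsCompact A ∧ IsGeodesicallyConvex K ρ A ∧
    ∃ e : ContinuousMap.HomotopyEquiv A (LocSymmSpace K ρ), ∀ a : A, e a = a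

end SymmetricSpace

end

/-! ### Word lengths and word metrics -/

section WordLength

variable {Γ : Type*} [Group Γ] {S : Set Γ}

/-! Everything rests on a coarse Serre lemma, `FourPoint.exists_forall_wordDist_le`: if the elements
of a finite set and the products of distinct pairs have short conjugates, then one point is moved
little by all of them. To see this, minimize the largest displacement over all points; if the
minimum were large, a step towards the image under a worst element would lower it, since all
elements of large displacement pull in the same direction (`FourPoint.le_twiceGromov_of_mul`). Apply
this to the images of the generators under an automorphism. Conjugating by the point found sends the
generators into a fixed finite ball, which leaves finitely many outer classes. So `n = 1` works, and
all three claims follow at once. -/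

lemma exists_word (hS : Subgroup.closure S = ⊤) (g : Γ) :
    ∃ l : List Γ, (∀ x ∈ l, x ∈ S ∨ x⁻¹ ∈ S) ∧ l.prod = g := by
  have hg : g ∈ (Subgroup.closure S).toSubmonoid := hS ▸ Subgroup.mem_top g
  rw [Subgroup.closure_toSubmonoid] at hg
  exact Submonoid.exists_list_of_mem_closure hg

lemma exists_minimal_word (hS : Subgroup.closure S = ⊤) (g : Γ) :
    ∃ l : List Γ, l.length = wordLength S g ∧ (∀ x ∈ l, x ∈ S ∨ x⁻¹ ∈ S) ∧ l.prod = g := by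
  obtain ⟨l, hl, hg⟩ := exists_word hS g
  exact Nat.sInf_mem (s := {n : ℕ | ∃ l : List Γ, l.length = n ∧
    (∀ x ∈ l, x ∈ S ∨ x⁻¹ ∈ S) ∧ l.prod = g}) ⟨l.length, l, rfl, hl, hg⟩

lemma wordLength_prod_le {l : List Γ} (hl : ∀ x ∈ l, x ∈ S ∨ x⁻¹ ∈ S) :
    wordLength S l.prod ≤ l.length :=
  Nat.sInf_le ⟨l, rfl, hl, rfl⟩

lemma wordLength_one : wordLength S (1 : Γ) = 0 :=
  Nat.le_zero.mp (wordLength_prod_le (S := S) (l := []) (by simp))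

lemma wordLength_mul_le (hS : Subgroup.closure S = ⊤) (g h : Γ) :
    wordLength S (g * h) ≤ wordLength S g + wordLength S h := by
  obtain ⟨l, hl, hlS, rfl⟩ := exists_minimal_word hS g
  obtain ⟨k, hk, hkS, rfl⟩ := exists_minimal_word hS h
  rw [← hl, ← hk, ← List.prod_append, ← List.length_append]
  refine wordLength_prod_le fun x hx => ?_
  rcases List.mem_append.mp hx with hx | hx
  exacts [hlS x hx, hkS x hx]

lemma wordLength_inv_le (hS : Subgroup.closure S = ⊤) (g : Γ) :
    wordLength S g⁻¹ ≤ wordLength S g := by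
  obtain ⟨l, hl, hlS, rfl⟩ := exists_minimal_word hS g
  rw [← hl, List.prod_inv_reverse]
  refine (wordLength_prod_le fun x hx => ?_).trans_eq (by simp)
  obtain ⟨y, hy, rfl⟩ : ∃ y ∈ l, y⁻¹ = x := by simpa using hx
  simpa [or_comm] using hlS y hy

lemma wordLength_inv (hS : Subgroup.closure S = ⊤) (g : Γ) :
    wordLength S g⁻¹ = wordLength S g :=
  (wordLength_inv_le hS g).antisymm (by simpa using wordLength_inv_le hS g⁻¹)

lemma wordDist_comm (hS : Subgroup.closure S = ⊤) (x y : Γ) :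
    wordDist S x y = wordDist S y x := by
  rw [wordDist, ← wordLength_inv hS, mul_inv_rev, inv_inv, wordDist]

lemma wordDist_triangle (hS : Subgroup.closure S = ⊤) (x y z : Γ) :
    wordDist S x z ≤ wordDist S x y + wordDist S y z := by
  simpa [wordDist, mul_assoc] using wordLength_mul_le hS (x⁻¹ * y) (y⁻¹ * z)

lemma wordDist_mul_left (g x y : Γ) : wordDist S (g * x) (g * y) = wordDist S x y := by
  simp [wordDist, mul_assoc]

lemma wordDist_self (x : Γ) : wordDist S x x = 0 := by
  simp [wordDist, wordLength_one]

lemma wordDist_inv_mul (g x y : Γ) : wordDist S (g⁻¹ * x) y = wordDist S x (g * y) := by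
  rw [← wordDist_mul_left g, mul_inv_cancel_left]

lemma exists_wordDist_eq (hS : Subgroup.closure S = ⊤) (x y : Γ) {r : ℕ}
    (hr : r ≤ wordDist S x y) :
    ∃ m, wordDist S x m = r ∧ wordDist S m y + r = wordDist S x y := by
  obtain ⟨l, hl, hlS, hlp⟩ := exists_minimal_word hS (x⁻¹ * y)
  change l.length = wordDist S x y at hl
  have h₁ : wordDist S x (x * (l.take r).prod) ≤ r := by
    rw [wordDist, inv_mul_cancel_left]
    exact (wordLength_prod_le fun z hz => hlS z (List.mem_of_mem_take hz)).trans (by simp)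
  have h₂ : wordDist S (x * (l.take r).prod) y ≤ wordDist S x y - r := by
    have : (x * (l.take r).prod)⁻¹ * y = (l.drop r).prod := by
      rw [mul_inv_rev, mul_assoc, ← hlp, ← List.prod_take_mul_prod_drop l r, inv_mul_cancel_left]
    rw [wordDist, this]
    exact (wordLength_prod_le fun z hz => hlS z (List.mem_of_mem_drop hz)).trans (by simp [hl])
  have := wordDist_triangle hS x (x * (l.take r).prod) y
  exact ⟨x * (l.take r).prod, by omega, by omega⟩

lemma finite_setOf_wordLength_le (hS : IsFiniteGenSet S) (N : ℕ) :
    {g : Γ | wordLength S g ≤ N}.Finite := by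
  have hA : {x : Γ | x ∈ S ∨ x⁻¹ ∈ S}.Finite :=
    hS.1.union (hS.1.preimage inv_injective.injOn)
  have := hA.to_subtype
  refine ((List.finite_length_le {x : Γ | x ∈ S ∨ x⁻¹ ∈ S} N).image
    fun l => (l.map Subtype.val).prod).subset fun g hg => ?_
  obtain ⟨l, hl, hlS, rfl⟩ := exists_minimal_word hS.2 g
  lift l to List {x : Γ | x ∈ S ∨ x⁻¹ ∈ S} using hlS
  exact ⟨l, by simpa using hl.trans_le hg, rfl⟩

lemma exists_wordDist_eq_conjLength (S : Set Γ) (γ : Γ) :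
    ∃ x, wordDist S x (γ * x) = conjLength S γ :=
  Nat.sInf_mem (Set.range_nonempty fun x : Γ => wordDist S x (γ * x))

lemma exists_wordLength_le_mul {T : Set Γ} (hS : Subgroup.closure S = ⊤) (hT : IsFiniteGenSet T) :
    ∃ M : ℕ, ∀ g, wordLength S g ≤ M * wordLength T g := by
  obtain ⟨M, hM⟩ := (hT.1.image (wordLength S)).bddAbove
  refine ⟨M, fun g => ?_⟩
  obtain ⟨l, hl, hlT, rfl⟩ := exists_minimal_word hT.2 g
  rw [← hl]
  clear hl
  induction l with
  | nil => simp [wordLength_one]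
  | cons a l ih =>
    have ha : wordLength S a ≤ M := by
      rcases hlT a (by simp) with h | h
      · exact hM ⟨a, h, rfl⟩
      · exact wordLength_inv hS a ▸ hM ⟨a⁻¹, h, rfl⟩
    have hmul := wordLength_mul_le hS a l.prod
    have := ih fun x hx => hlT x (by simp [hx])
    rw [List.prod_cons, List.length_cons]
    linarith

end WordLength

/-! ### Gromov products and the coarse Serre lemma -/

section Hyperbolic

variable {Γ : Type*} [Group Γ]

/-- The four-point condition for the word metric of `S`. -/
def FourPoint (S : Set Γ) (δ : ℝ) : Prop :=
  ∀ x y z w : Γ, (wordDist S x z : ℝ) + wordDist S y w ≤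
    max ((wordDist S x y : ℝ) + wordDist S z w) ((wordDist S x w : ℝ) + wordDist S y z) + 2 * δ

/-- Twice the Gromov product of `u` and `v` based at `x`. -/
noncomputable def twiceGromov (S : Set Γ) (x u v : Γ) : ℝ :=
  wordDist S x u + wordDist S x v - wordDist S u v

variable {S : Set Γ} {δ : ℝ}

lemma FourPoint.nonneg (h : FourPoint S δ) : 0 ≤ δ := by
  have := h 1 1 1 1
  simp only [wordDist_self, Nat.cast_zero, add_zero, max_self] at this
  linarith

lemma twiceGromov_comm (hS : Subgroup.closure S = ⊤) (x u v : Γ) :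
    twiceGromov S x u v = twiceGromov S x v u := by
  rw [twiceGromov, twiceGromov, wordDist_comm hS u v]
  ring

/-- The four-point condition with `x` as one vertex makes "same direction from `x`" transitive, at a
cost of `2 * δ` per use. -/
lemma FourPoint.le_twiceGromov (h : FourPoint S δ) (hS : Subgroup.closure S = ⊤) {x u v w : Γ}
    {a : ℝ} (huv : a ≤ twiceGromov S x u v) (hvw : a ≤ twiceGromov S x v w) :
    a - 2 * δ ≤ twiceGromov S x u w := by
  have := h u v w x
  unfold twiceGromov at *
  rw [wordDist_comm hS x u, wordDist_comm hS x v, wordDist_comm hS x w] at *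
  rcases le_max_iff.mp (sub_le_iff_le_add.mpr this) with h | h <;> linarith

/-- An element which moves some point by at most `K` nearly backtracks on every orbit. -/
lemma FourPoint.le_twiceGromov_inv (h : FourPoint S δ) (hS : Subgroup.closure S = ⊤) {g y : Γ}
    {K : ℝ} (hy : wordDist S y (g * y) ≤ K) (x : Γ) :
    wordDist S x (g * x) - (K + 2 * δ) ≤ twiceGromov S x (g⁻¹ * x) (g * x) := by
  -- Either term of the maximum bounds the distance from `x` to `g * (g * x)` by that from `x` to `g
  -- * x` plus `K + 2 * δ`.
  have h₀ := h x (g * x) (g * (g * x)) y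
  have h₁ : wordDist S (g * (g * x)) y ≤ wordDist S (g * x) y + wordDist S y (g * y) := by
    refine (wordDist_triangle hS _ (g * y) _).trans_eq ?_
    rw [wordDist_mul_left, wordDist_comm hS (g * y)]
  have h₂ : wordDist S x y ≤ wordDist S (g * x) y + wordDist S y (g * y) := by
    rw [← wordDist_mul_left g]
    exact wordDist_triangle hS _ _ _
  have h₃ : wordDist S x (g⁻¹ * x) = wordDist S x (g * x) := by
    rw [wordDist_comm hS, wordDist_inv_mul]
  rw [wordDist_mul_left] at h₀
  rw [twiceGromov, wordDist_inv_mul, h₃]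
  rify at h₁ h₂
  rcases le_max_iff.mp (sub_le_iff_le_add.mpr h₀) with h | h <;> linarith

/-- If `s`, `t` and `s * t` have short conjugates, but `s` and `t` have large and comparable
displacement at `x`, then `s⁻¹ * x` and `t * x` lie in the same direction from `x`. -/
lemma FourPoint.le_twiceGromov_of_mul (h : FourPoint S δ) (hS : Subgroup.closure S = ⊤)
    {s t x y₁ y₂ y₃ : Γ} {K R L : ℝ} (hK : 0 ≤ K) (hR : 0 ≤ R)
    (h₁ : wordDist S y₁ (s * y₁) ≤ K) (h₂ : wordDist S y₂ (t * y₂) ≤ K)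
    (h₃ : wordDist S y₃ (s * t * y₃) ≤ K)
    (hs : L - R ≤ wordDist S x (s * x)) (ht : L - R ≤ wordDist S x (t * x))
    (hL : 3 * R + K + 10 * δ ≤ L) :
    R ≤ twiceGromov S x (s⁻¹ * x) (t * x) := by
  by_contra! hlt
  have hδ := h.nonneg
  have inv (g : Γ) : wordDist S x (g⁻¹ * x) = wordDist S x (g * x) := by
    rw [wordDist_comm hS, wordDist_inv_mul]
  have e₁ := h.le_twiceGromov_inv hS h₁ x
  have e₂ := h.le_twiceGromov_inv hS h₂ x
  have e₃ := h.le_twiceGromov_inv hS h₃ x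
  -- If the directions differ, `s * t` displaces `x` by almost the sum of the two displacements.
  -- Then `s * t * x` lies towards `s * x`, and `(s * t)⁻¹ * x` towards `t⁻¹ * x`.
  have far : wordDist S x (s * x) + wordDist S x (t * x) - R ≤ wordDist S x (s * t * x) := by
    rw [twiceGromov, inv, wordDist_inv_mul, ← mul_assoc] at hlt
    linarith
  have p₁ : 2 * (L - R) - R - K - 2 * δ ≤ twiceGromov S x (s * x) (s * t * x) := by
    rw [twiceGromov, mul_assoc, wordDist_mul_left, ← mul_assoc]
    linarith
  have p₂ : 2 * (L - R) - R - K - 2 * δ ≤ twiceGromov S x ((s * t)⁻¹ * x) (t⁻¹ * x) := by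
    rw [twiceGromov, inv, inv, mul_inv_rev, mul_assoc t⁻¹,
      wordDist_mul_left, wordDist_comm hS _ x, inv]
    linarith
  have p₃ : 2 * (L - R) - R - K - 2 * δ ≤
      twiceGromov S x (s * t * x) ((s * t)⁻¹ * x) := by
    rw [twiceGromov_comm hS]
    linarith
  -- Chain of directions: `s⁻¹ * x`, `s * x`, `s * t * x`, `(s * t)⁻¹ * x`, `t⁻¹ * x`, `t * x`.
  have p₄ := h.le_twiceGromov hS (h.le_twiceGromov hS p₁ p₃) (by linarith [p₂])
  have p₅ := h.le_twiceGromov hS (x := x) (u := s⁻¹ * x) (v := s * x) (w := t⁻¹ * x)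
    (a := R + 4 * δ) (by linarith) (by linarith)
  have p₆ := h.le_twiceGromov hS (x := x) (u := s⁻¹ * x) (v := t⁻¹ * x) (w := t * x)
    (a := R + 2 * δ) (by linarith) (by linarith)
  linarith

/-- Moving `x` towards a point that is in the direction of both `t * x` and `t⁻¹ * x` decreases
the displacement of `t`. -/
lemma FourPoint.wordDist_mul_le (h : FourPoint S δ) (hS : Subgroup.closure S = ⊤) {t x m : Γ}
    {r c : ℝ} (hm : wordDist S x m = r) (hr : 2 * r ≤ wordDist S x (t * x)) (hc : 0 ≤ c)
    (h₁ : 2 * r - c ≤ twiceGromov S x m (t * x)) (h₂ : 2 * r - c ≤ twiceGromov S x m (t⁻¹ * x)) :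
    wordDist S m (t * m) ≤ wordDist S x (t * x) - 2 * r + 2 * c + 2 * δ := by
  have h₀ := h m x (t * m) (t * x)
  have inv : wordDist S x (t⁻¹ * x) = wordDist S x (t * x) := by
    rw [wordDist_comm hS, wordDist_inv_mul]
  rw [wordDist_mul_left, wordDist_comm hS m x] at h₀
  rw [twiceGromov] at h₁ h₂
  rw [wordDist_comm hS m (t⁻¹ * x), wordDist_inv_mul, inv] at h₂
  rcases le_max_iff.mp (sub_le_iff_le_add.mpr h₀) with h | h <;> linarith

/-- A hyperbolic version of Serre's lemma on fixed points of groups acting on trees. -/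
theorem FourPoint.exists_forall_wordDist_le (h : FourPoint S δ) (hS : Subgroup.closure S = ⊤)
    (K : ℕ) : ∃ N : ℕ, ∀ F : Set Γ, F.Finite → (∀ s ∈ F, conjLength S s ≤ K) →
      (∀ s ∈ F, ∀ t ∈ F, s ≠ t → conjLength S (s * t) ≤ K) →
      ∃ x, ∀ s ∈ F, wordDist S x (s * x) ≤ N := by
  have hδ := h.nonneg
  -- A step of length `r` gains `2 * r - 14 * δ ≥ 2`; `N` meets the threshold of
  -- `FourPoint.le_twiceGromov_of_mul` with `R = 2 * r`.
  obtain ⟨r, hr⟩ := exists_nat_ge (7 * δ + 1)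
  obtain ⟨N, hN⟩ := exists_nat_ge (6 * r + K + 10 * δ : ℝ)
  refine ⟨N, fun F hF h₁ h₂ => ?_⟩
  have short (g : Γ) (hg : conjLength S g ≤ K) : ∃ y, (wordDist S y (g * y) : ℝ) ≤ K := by
    obtain ⟨y, hy⟩ := exists_wordDist_eq_conjLength S g
    exact ⟨y, by exact_mod_cast hy.trans_le hg⟩
  have hex : ∃ n x, ∀ s ∈ F, wordDist S x (s * x) ≤ n := by
    obtain ⟨n, hn⟩ := (hF.image fun s => wordDist S 1 (s * 1)).bddAbove
    exact ⟨n, 1, fun s hs => hn ⟨s, hs, rfl⟩⟩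
  classical
  obtain ⟨x, hx⟩ := Nat.find_spec hex
  have hmin := fun n => Nat.find_min hex (m := n)
  set L := Nat.find hex
  by_cases hLN : L ≤ N
  · exact ⟨x, fun s hs => (hx s hs).trans hLN⟩
  exfalso
  push Not at hLN
  refine hmin (L - 1) (by omega) ?_
  by_cases hlt : ∀ s ∈ F, wordDist S x (s * x) ≤ L - 1
  · exact ⟨x, hlt⟩
  push Not at hlt
  obtain ⟨s, hs, hsx⟩ := hlt
  have hsL : wordDist S x (s * x) = L := by have := hx s hs; omega
  have hLN' : (N : ℝ) + 1 ≤ L := by exact_mod_cast hLN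
  have hK : (0 : ℝ) ≤ K := K.cast_nonneg
  have hrL : r ≤ L := by
    rify
    linarith
  obtain ⟨m, hm, hms⟩ := exists_wordDist_eq hS x (s * x) (hrL.trans_eq hsL.symm)
  refine ⟨m, fun t ht => ?_⟩
  -- Moving the point by `r` raises a displacement by at most `2 * r`, so only nearly maximal ones
  -- matter.
  by_cases hbig : wordDist S x (t * x) + 2 * r < L
  · have e₁ := wordDist_triangle hS m x (t * m)
    have e₂ := wordDist_triangle hS x (t * x) (t * m)
    rw [wordDist_mul_left] at e₂
    rw [wordDist_comm hS m x] at e₁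
    omega
  have hbig' : (L : ℝ) ≤ wordDist S x (t * x) + 2 * r := by exact_mod_cast not_lt.mp hbig
  have htL : (wordDist S x (t * x) : ℝ) ≤ L := by exact_mod_cast hx t ht
  have hsL' : (wordDist S x (s * x) : ℝ) = L := by exact_mod_cast hsL
  obtain ⟨y₁, hy₁⟩ := short s (h₁ s hs)
  obtain ⟨y₂, hy₂⟩ := short t (h₁ t ht)
  have b₁ := h.le_twiceGromov_inv hS hy₁ x
  have b₂ := h.le_twiceGromov_inv hS hy₂ x
  have q₁ : 2 * (r : ℝ) ≤ twiceGromov S x (s⁻¹ * x) (t * x) := by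
    by_cases hst : s = t
    · subst hst
      linarith
    · obtain ⟨y₃, hy₃⟩ := short (s * t) (h₂ s hs t ht hst)
      exact h.le_twiceGromov_of_mul hS hK (by linarith) hy₁ hy₂ hy₃ (L := L)
        (by linarith) (by linarith) (by linarith)
  have q₂ := h.le_twiceGromov hS (u := s * x)
    (by rw [twiceGromov_comm hS]; linarith : 2 * (r : ℝ) ≤ _) q₁
  have q₃ := h.le_twiceGromov hS q₂ (w := t⁻¹ * x)
    (by rw [twiceGromov_comm hS]; linarith)
  have q₀ : 2 * (r : ℝ) ≤ twiceGromov S x m (s * x) := by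
    rw [twiceGromov]
    rify at hm hms
    linarith
  have q₄ := h.le_twiceGromov hS (by linarith : 2 * (r : ℝ) - 4 * δ ≤ _)
    (by linarith : 2 * (r : ℝ) - 4 * δ ≤ twiceGromov S x (s * x) (t * x))
  have q₅ := h.le_twiceGromov hS (by linarith : 2 * (r : ℝ) - 4 * δ ≤ _)
    (by linarith : 2 * (r : ℝ) - 4 * δ ≤ twiceGromov S x (s * x) (t⁻¹ * x))
  -- At most three uses of transitivity, at `2 * δ` each, give `c = 6 * δ`.
  have key := h.wordDist_mul_le hS (t := t) (c := 6 * δ) (congrArg Nat.cast hm) (by linarith)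
    (by linarith) (by linarith) (by linarith)
  have : (wordDist S m (t * m) : ℝ) + 1 ≤ L := by linarith
  have : wordDist S m (t * m) + 1 ≤ L := by exact_mod_cast this
  omega

end Hyperbolic

/-! ### Finiteness in the outer automorphism group -/

section OuterAutomorphisms

variable {Γ : Type*} [Group Γ]

lemma mk_conj_mul (g : Γ) (f : MulAut Γ) :
    ((MulAut.conj g * f : MulAut Γ) : OutAut Γ) = (f : OutAut Γ) := by
  refine (QuotientGroup.eq.mpr (MonoidHom.mem_range.mpr ⟨f⁻¹ g, ?_⟩)).symm
  ext x
  simp [MulAut.mul_apply]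

lemma finite_setOf_mulAut {S B : Set Γ} (hS : IsFiniteGenSet S) (hB : B.Finite) :
    {f : MulAut Γ | ∀ s ∈ S, f s ∈ B}.Finite := by
  have := hS.1.to_subtype
  refine Set.Finite.of_finite_image (f := fun f (s : S) => f s)
    ((Set.Finite.pi' fun _ => hB).subset ?_) ?_
  · rintro _ ⟨f, hf, rfl⟩ s
    exact hf s s.2
  · intro f _ f' _ hff
    have : (f : Γ →* Γ) = f' :=
      MonoidHom.eq_of_eqOn_dense hS.2 fun s hs => congrFun hff ⟨s, hs⟩
    exact MulEquiv.toMonoidHom_injective this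

/-- In a word hyperbolic group, conjugacy length bounds on a finite generating set and on the
products of pairs of its distinct elements leave only finitely many outer automorphisms. -/
theorem IsWordHyperbolic.boundsOuterAutomorphisms (hyp : IsWordHyperbolic Γ) {S T B : Set Γ}
    (hT : IsFiniteGenSet T) (hS : IsFiniteGenSet S) (hSB : S ⊆ B)
    (hB : ∀ s ∈ S, ∀ t ∈ S, s ≠ t → s * t ∈ B) : BoundsOuterAutomorphisms T B := by
  obtain ⟨U, hU, δ, hδ⟩ := hyp
  intro K
  obtain ⟨k, hk⟩ := exists_nat_ge K
  -- The four-point condition is known only for `U`, so bounds in `T` are transferred to `U`.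
  obtain ⟨M, hM⟩ := exists_wordLength_le_mul hU.2 hT
  obtain ⟨N, hN⟩ := FourPoint.exists_forall_wordDist_le hδ hU.2 (M * k)
  refine ((finite_setOf_mulAut hS (finite_setOf_wordLength_le hU N)).image
    (fun f : MulAut Γ => (f : OutAut Γ))).subset fun φ hφ => ?_
  induction φ using QuotientGroup.induction_on with | H f => ?_
  have hf (β : Γ) (hβ : β ∈ B) : conjLength U (f β) ≤ M * k := by
    obtain ⟨x, hx⟩ := exists_wordDist_eq_conjLength T (f β)
    have hle : conjLength T (f β) ≤ k := by
      have : (conjLength T (f β) : ℝ) ≤ K := hφ β hβ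
      exact_mod_cast this.trans hk
    calc conjLength U (f β) ≤ wordDist U x (f β * x) := Nat.sInf_le ⟨x, rfl⟩
      _ ≤ M * wordDist T x (f β * x) := hM _
      _ ≤ M * k := Nat.mul_le_mul_left M (hx.trans_le hle)
  obtain ⟨x, hx⟩ := hN (f '' S) (hS.1.image f)
    (by rintro _ ⟨s, hs, rfl⟩; exact hf s (hSB hs))
    (by
      rintro _ ⟨s, hs, rfl⟩ _ ⟨t, ht, rfl⟩ hst
      rw [← map_mul]
      exact hf _ (hB s hs t ht fun h => hst (congrArg f h)))
  refine ⟨MulAut.conj x⁻¹ * f, fun s hs => ?_, mk_conj_mul _ _⟩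
  have := hx (f s) ⟨s, hs, rfl⟩
  simpa [wordDist, MulAut.mul_apply, mul_assoc] using this

end OuterAutomorphisms

theorem mainTheorem1 {Γ : Type*} [Group Γ]
    (hyp : IsWordHyperbolic Γ) (torsionFree : ∀ g : Γ, IsOfFinOrder g → g = 1)
    (T : Set Γ) (hT : IsFiniteGenSet T) :
    (∃ B : Set Γ, B.Finite ∧ BoundsOuterAutomorphisms T B) ∧
    (∀ S : Set Γ, IsFiniteGenSet S → ∃ n : ℕ, 0 < n ∧
      BoundsOuterAutomorphisms T
        ({β | ∃ s ∈ S, β = s ^ n} ∪ {β | ∃ s ∈ S, ∃ t ∈ S, s ≠ t ∧ β = s ^ n * t ^ n})) ∧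
    (∀ (d : ℕ) (G : Type*) [Group G] [TopologicalSpace G]
      [ChartedSpace (EuclideanSpace ℝ (Fin d)) G] [LieGroup (𝓡 d) ∞ G]
      (_ : IsRankOneLieGroup d G) (K : Subgroup G) (_ : IsMaximalCompactSubgroup K)
      (ρ : Γ →* G) (_ : IsConvexCocompact K ρ),
      ∀ S : Set Γ, IsFiniteGenSet S → BoundsOuterAutomorphisms T (S ∪ S * S)) := by
  refine ⟨?_, fun S hS => ⟨1, one_pos, ?_⟩, fun _ _ _ _ _ _ _ _ _ _ _ S hS => ?_⟩
  · obtain ⟨S, hS, -⟩ := id hyp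
    exact ⟨S ∪ S * S, hS.1.union (hS.1.mul hS.1),
      hyp.boundsOuterAutomorphisms hT hS Set.subset_union_left
        fun s hs t ht _ => Or.inr (Set.mul_mem_mul hs ht)⟩
  · exact hyp.boundsOuterAutomorphisms hT hS (fun s hs => Or.inl ⟨s, hs, (pow_one s).symm⟩)
      fun s hs t ht hst => Or.inr ⟨s, hs, t, ht, hst, by rw [pow_one, pow_one]⟩
  · exact hyp.boundsOuterAutomorphisms hT hS Set.subset_union_left
      fun s hs t ht _ => Or.inr (Set.mul_mem_mul hs ht)
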